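/- Let $H_3(\mathbb Z)$ be the discrete Heisenberg group of integer matrices $\begin{pmatrix}1&a&b\\0&1&c\\0&0&1\end{pmatrix}$, with identity $I$, let $A$ and $B$ be the matrices with $(a,b,c)=(1,0,0)$ and $(0,0,1)$ respectively, and let $C_2=\{0,1\}$ be the cyclic group of order two, written additively. Put $F=\{A,B,A^2,A^2B,B^2\}$, $\Gamma=C_2\times H_3(\mathbb Z)$ and $E=C_2\times(F\cup F^{-1})$, and let $G=\operatorname{Cay}(\Gamma,E)$ be the graph on $\Gamma$ with edges $(x,x\gamma)$ for $\gamma\in E$. Definitions. $\operatorname{Aut}_e(G)$ is the group of automorphisms of $G$ that fix the identity $e$, with the topology of pointwise convergence. The group $\Gamma$ acts on it by $\gamma\cdot r=\langle r(\gamma^{-1})\rangle^{-1}\circ r\circ\langle\gamma^{-1}\rangle$, where $\langle\gamma\rangle(\delta)=\gamma\delta$. A Cayley diagram on $G$ is a labelling $d$ of the edges (ordered pairs of neighbours) of $G$ by elements of $E$ such that at every vertex $x$ each $\gamma\in E$ is the label $d(x,y)$ for exactly one neighbour $y$ of $x$, and such that for every walk $(x_0,\dots,x_n)$ in $G$ we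 have $d(x_0,x_1)\cdots d(x_{n-1},x_n)=e$ if and only if $x_0=x_n$; $\mathrm{CD}$ is the set of Cayley diagrams. The group $\operatorname{Aut}(G)$ acts on $[0,1]^\Gamma$ and on edge labellings by $f\cdot x=x\circ f^{-1}$. We say that $G$ admits an $\operatorname{Aut}(G)$-f.i.i.d. Cayley diagram if there are a measurable map $\Phi$ from $[0,1]^\Gamma$ to the edge labellings and a measurable $\operatorname{Aut}(G)$-invariant set of full $\lambda^\Gamma$-measure ($\lambda$ is Lebesgue measure) on which $\Phi$ is $\operatorname{Aut}(G)$-equivariant, such that $\Phi(x)\in\mathrm{CD}$ for $\lambda^\Gamma$-almost every $x$. Theorem. 1. $E$ is a finite symmetric generating set of $\Gamma$, and $G$ admits an $\operatorname{Aut}(G)$-f.i.i.d. Cayley diagram. 2. $|\mathrm{CD}|=|\operatorname{Aut}_e(G)|>1$. 3. There is an isomorphism of topological groups $f\colon\operatorname{Aut}_e(G)\to C_2^{H_3(\mathbb Z)\setminus\{I\}}$ such that $r(a,m)=(a+f(r)(m),m)$ for all $r\in\operatorname{Aut}_e(G)$, $a\in C_2$ and $m\in H_3(\mathbb Z)$,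 where elements $x$ of $C_2^{H_3(\mathbb Z)\setminus\{I\}}$ are extended by $x(I)=0$. Under $f$ the action of $\Gamma$ becomes $((b,\ell)\cdot x)(m)=x(\ell^{-1})+x(\ell^{-1}m)$. 4. The map $\Psi\colon C_2^\Gamma\to C_2^{H_3(\mathbb Z)\setminus\{I\}}$, $\Psi(y)(m)=y(0,m)+y(1,m)+y(0,I)+y(1,I)$, is a surjective continuous group homomorphism, is equivariant for the shift action $(\gamma\cdot y)(\delta)=y(\gamma^{-1}\delta)$ of $\Gamma$ on $C_2^\Gamma$ and the action in (3), and pushes the product of the uniform measures on $C_2$ (which is the Haar probability measure of $C_2^\Gamma$) forward to the Haar probability measure of $C_2^{H_3(\mathbb Z)\setminus\{I\}}$. -/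

import Mathlib

open MeasureTheory
open scoped Pointwise Cardinal

namespace CayleyFIID

section General

/-! ### Cayley graphs, their automorphisms, and Cayley diagrams -/

/-- Edges are the pairs `(x, x * γ)` with `γ ∈ S`. Mathlib's `mulCayley` also symmetrises `S` and
omits loops, which changes nothing when `S` is symmetric and does not contain the identity. -/
abbrev Cay {Γ : Type*} [Group Γ] (S : Set Γ) : SimpleGraph Γ := SimpleGraph.mulCayley S

/-- The automorphism group; multiplication is composition. -/
abbrev CayAut {Γ : Type*} [Group Γ] (S : Set Γ) : Type _ := Cay S ≃g Cay S

/-- The topology of pointwise convergence on the automorphism group of a graph, the vertex set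
being discrete. -/
instance autTopology {V : Type*} (G : SimpleGraph V) : TopologicalSpace (G ≃g G) :=
  TopologicalSpace.induced (fun f v => f v) (@Pi.topologicalSpace V (fun _ => V) fun _ => ⊥)

/-- The group of rotations: automorphisms of the Cayley graph that fix the identity. -/
def rotations {Γ : Type*} [Group Γ] (S : Set Γ) : Subgroup (CayAut S) where
  carrier := {r | r 1 = 1}
  one_mem' := rfl
  mul_mem' {r s} hr hs := by
    change r (s 1) = 1
    rw [show s 1 = 1 from hs]
    exact hr
  inv_mem' {r} hr := by
    change r.symm 1 = 1
    rw [RelIso.symm_apply_eq]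
    exact (show r 1 = 1 from hr).symm

/-- Left translation `δ ↦ γ * δ`, as an automorphism of the Cayley graph. -/
def leftMul {Γ : Type*} [Group Γ] (S : Set Γ) (γ : Γ) : CayAut S where
  toEquiv := Equiv.mulLeft γ
  map_rel_iff' {x y} := by
    simp [SimpleGraph.mulCayley_adj', mul_assoc]

/-- The action of `Γ` on the group of rotations,
`γ · r = ⟨r(γ⁻¹)⟩⁻¹ ∘ r ∘ ⟨γ⁻¹⟩`, where `⟨γ⟩` is left translation by `γ`. -/
def rotAction {Γ : Type*} [Group Γ] (S : Set Γ) (γ : Γ) (r : rotations S) : rotations S :=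
  ⟨(leftMul S (r.1 γ⁻¹))⁻¹ * r.1 * leftMul S γ⁻¹, by
    change (leftMul S (r.1 γ⁻¹)).symm (r.1 (γ⁻¹ * 1)) = 1
    rw [RelIso.symm_apply_eq]
    simp [leftMul]⟩

/-- Labellings of the edges (ordered pairs of neighbours) by elements of `S`. -/
def EdgeLabelling {Γ : Type*} [Group Γ] (S : Set Γ) : Type _ := (Cay S).Dart → S

/-- The product σ-algebra, the set of labels being discrete. -/
instance {Γ : Type*} [Group Γ] (S : Set Γ) : MeasurableSpace (EdgeLabelling S) :=
  @MeasurableSpace.pi (Cay S).Dart (fun _ => S) fun _ => ⊤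

/-- The action of the automorphism group on edge labellings,
`(f · d)(x, y) = d (f⁻¹ x, f⁻¹ y)`. -/
def edgeShift {Γ : Type*} [Group Γ] {S : Set Γ} (f : CayAut S) (d : EdgeLabelling S) :
    EdgeLabelling S :=
  fun e => d (SimpleGraph.Hom.mapDart f.symm.toHom e)

/-- The action of the automorphism group on vertex labellings, `(f · x)(v) = x (f⁻¹ v)`. -/
def vertexShift {Γ : Type*} [Group Γ] {S : Set Γ} {α : Type*} (f : CayAut S) (x : Γ → α) :
    Γ → α :=
  fun v => x (f.symm v)

/-- The product in `Γ` of the labels along a walk. -/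
def labelProd {Γ : Type*} [Group Γ] {S : Set Γ} (d : EdgeLabelling S) {x y : Γ}
    (p : (Cay S).Walk x y) : Γ :=
  (p.darts.map fun e => (d e : Γ)).prod

/-- Cayley diagrams: at every vertex each generator labels exactly one outgoing edge, and a walk
is closed exactly when the product of its labels is the identity. -/
structure IsCayleyDiagram {Γ : Type*} [Group Γ] {S : Set Γ} (d : EdgeLabelling S) : Prop where
  at_most_one : ∀ e e' : (Cay S).Dart, e.fst = e'.fst → d e = d e' → e = e'
  exists_edge : ∀ (x : Γ) (γ : S), ∃ e : (Cay S).Dart, e.fst = x ∧ d e = γ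
  closed_iff : ∀ (x y : Γ) (p : (Cay S).Walk x y), labelProd d p = 1 ↔ x = y

/-- The space of Cayley diagrams. -/
def CD {Γ : Type*} [Group Γ] (S : Set Γ) : Set (EdgeLabelling S) := {d | IsCayleyDiagram d}

/-! ### Factors of i.i.d. -/

/-- `F` is a factor map from the system `(X, μ)` to the system `(Y, ν)`, for actions `a` and `b` of
`K`: it is measurable, pushes `μ` to `ν`, and is equivariant on an invariant conull set. -/
structure IsFactorMap {K X Y : Type*} [MeasurableSpace X] [MeasurableSpace Y]
    (a : K → X → X) (b : K → Y → Y) (μ : Measure X) (ν : Measure Y) (F : X → Y) : Prop where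
  measurable : Measurable F
  map_eq : μ.map F = ν
  equivariant : ∃ X₀ : Set X, MeasurableSet X₀ ∧ μ X₀ᶜ = 0 ∧ (∀ k, ∀ x ∈ X₀, a k x ∈ X₀) ∧
    ∀ k, ∀ x ∈ X₀, F (a k x) = b k (F x)

/-- The measure `λ^Γ` on `[0,1]^Γ`, for `λ` Lebesgue measure. -/
noncomputable def iidMeasure (Γ : Type*) : Measure (Γ → unitInterval) :=
  Measure.infinitePi fun _ : Γ => (volume : Measure unitInterval)

/-- A measure on edge labellings is a factor of i.i.d. for the full automorphism group. -/
def IsAutFIID {Γ : Type*} [Group Γ] {S : Set Γ} (ν : Measure (EdgeLabelling S)) : Prop :=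
  ∃ F : (Γ → unitInterval) → EdgeLabelling S,
    IsFactorMap (K := CayAut S) vertexShift edgeShift (iidMeasure Γ) ν F

/-- The Cayley graph admits a Cayley diagram that is a factor of i.i.d. for its full automorphism
group. -/
def AdmitsAutFIIDCayleyDiagram {Γ : Type*} [Group Γ] (S : Set Γ) : Prop :=
  ∃ ν : Measure (EdgeLabelling S), IsAutFIID ν ∧ ∀ᵐ d ∂ν, d ∈ CD S

end General

section Heisenberg

/-! ### The marked group -/

/-- The integer matrix with rows `(1, a, b)`, `(0, 1, c)`, `(0, 0, 1)`. -/
def heis (a b c : ℤ) : Matrix.SpecialLinearGroup (Fin 3) ℤ :=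
  ⟨!![1, a, b; 0, 1, c; 0, 0, 1], by simp [Matrix.det_fin_three]⟩

theorem heis_mul (a b c a' b' c' : ℤ) :
    heis a b c * heis a' b' c' = heis (a + a') (b' + a * c' + b) (c + c') := by
  ext i j
  rw [Matrix.SpecialLinearGroup.coe_mul, Matrix.mul_apply, Fin.sum_univ_three]
  fin_cases i <;> fin_cases j <;> simp [heis] <;> ring

theorem heis_zero : heis 0 0 0 = 1 := by
  ext i j
  fin_cases i <;> fin_cases j <;> simp [heis]

/-- The discrete Heisenberg group `H₃(ℤ)`. -/
def H3 : Subgroup (Matrix.SpecialLinearGroup (Fin 3) ℤ) where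
  carrier := {M | ∃ a b c : ℤ, M = heis a b c}
  one_mem' := ⟨0, 0, 0, heis_zero.symm⟩
  mul_mem' := by
    rintro _ _ ⟨a, b, c, rfl⟩ ⟨a', b', c', rfl⟩
    exact ⟨_, _, _, heis_mul a b c a' b' c'⟩
  inv_mem' := by
    rintro _ ⟨a, b, c, rfl⟩
    refine ⟨-a, a * c - b, -c, inv_eq_of_mul_eq_one_right ?_⟩
    rw [heis_mul, ← heis_zero]
    congr 1 <;> ring

instance : Countable H3 := by
  have : Countable (Matrix (Fin 3) (Fin 3) ℤ) := inferInstanceAs (Countable (Fin 3 → Fin 3 → ℤ))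
  exact Function.Injective.countable
    (f := fun M : H3 => (M.1.1 : Matrix (Fin 3) (Fin 3) ℤ))
    fun _ _ h => Subtype.ext (Subtype.ext h)

def matA : H3 := ⟨heis 1 0 0, 1, 0, 0, rfl⟩

def matB : H3 := ⟨heis 0 0 1, 0, 0, 1, rfl⟩

/-- The set `F = {A, B, A², A²B, B²}`. -/
def heisF : Set H3 := {matA, matB, matA ^ 2, matA ^ 2 * matB, matB ^ 2}

/-- The cyclic group of order two, written multiplicatively. -/
abbrev C2 : Type := Multiplicative (ZMod 2)

instance : MeasurableSpace C2 := ⊤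

instance : DiscreteTopology C2 := ⟨rfl⟩

instance : BorelSpace C2 := ⟨borel_eq_top_of_discrete.symm⟩

abbrev HGroup : Type := C2 × H3

/-- The generating set `C₂ × (F ∪ F⁻¹)`. -/
def genE : Set HGroup := Set.univ ×ˢ (heisF ∪ heisF⁻¹)

/-! ### The coordinates on the group of rotations -/

/-- The compact group `C₂^{H₃(ℤ) ∖ {I}}`. -/
abbrev Switch : Type := {m : H3 // m ≠ 1} → C2

/-- The extension of `x` to all of `H₃(ℤ)` by the identity of `C₂` at `I`. -/
noncomputable def Switch.ext (x : Switch) (m : H3) : C2 :=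
  open Classical in if h : m ≠ 1 then x ⟨m, h⟩ else 1

/-- The action of `C₂ × H₃(ℤ)` on `C₂^{H₃(ℤ) ∖ {I}}`; additively,
`((b, ℓ) · x)(m) = x(ℓ⁻¹) + x(ℓ⁻¹ m)`. -/
noncomputable def switchAction (γ : HGroup) (x : Switch) : Switch :=
  fun m => x.ext γ.2⁻¹ * x.ext (γ.2⁻¹ * m.1)

/-- The shift action on `C₂^Γ`, `(γ · y)(δ) = y(γ⁻¹ δ)`. -/
def coinShift (γ : HGroup) (y : HGroup → C2) : HGroup → C2 := fun δ => y (γ⁻¹ * δ)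

/-- The law of a family of independent fair coins indexed by `Γ`. -/
noncomputable def coinMeasure : Measure (HGroup → C2) :=
  Measure.infinitePi fun _ : HGroup => (PMF.uniformOfFintype C2).toMeasure

/-- The map `C₂^Γ → C₂^{H₃(ℤ) ∖ {I}}`; additively,
`y ↦ (m ↦ y(0, m) + y(1, m) + y(0, I) + y(1, I))`. -/
def coinMap (y : HGroup → C2) : Switch := fun m =>
  y (Multiplicative.ofAdd 0, m.1) * y (Multiplicative.ofAdd 1, m.1) *
    y (Multiplicative.ofAdd 0, 1) * y (Multiplicative.ofAdd 1, 1)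

end Heisenberg

end CayleyFIID

namespace CayleyFIID

/-! ### Cayley graphs of symmetric sets -/

/-! Write `heisT` for `F ∪ F⁻¹`. Adjacency in the Cayley graph of `C₂ × H₃(ℤ)` depends only on the
`H₃(ℤ)` coordinates, so the two points of a fibre over `H₃(ℤ)` are twins, and points of different
fibres are not (`eq_one_of_smul_heisT`). Every automorphism therefore permutes the fibres and
induces an automorphism of the Cayley graph of `H₃(ℤ)` with respect to `heisT`. That graph is rigid:
a check on the ten neighbours of the identity shows that its automorphisms are left translations
(`link_iso_fixes`, `heis_rigid`). A rotation thus preserves each fibre and swaps or fixes its two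
points, independently over all `m ≠ I`; this is the isomorphism with `C₂^{H₃(ℤ) ∖ {I}}`.

Cayley diagrams are the labellings `(x, y) ↦ r(x)⁻¹ r(y)` with `r` a rotation, `r` being recovered
by multiplying labels along walks from the identity (`IsCayleyDiagram.exists_rotation`,
`rotation_ext`).

To choose a diagram equivariantly it is enough to choose a zero in each fibre, and the i.i.d. labels
do this: take the point with the larger label (`largerLabel_comp`). What remains of an automorphism
is a left translation, which cancels in `r(x)⁻¹ r(y)`. -/

theorem cay_adj {Γ : Type*} [Group Γ] {S : Set Γ} (hS : S⁻¹ = S) (h1 : (1 : Γ) ∉ S) (u v : Γ) :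
    (Cay S).Adj u v ↔ u⁻¹ * v ∈ S := by
  rw [SimpleGraph.mulCayley_adj]
  constructor
  · rintro ⟨-, h | h⟩
    · exact h
    · rw [← hS]
      simpa using h
  · refine fun h => ⟨?_, Or.inl h⟩
    rintro rfl
    exact h1 (by simpa using h)

theorem exists_walk {Γ : Type*} [Group Γ] {S : Set Γ} (hS : S⁻¹ = S) (h1 : (1 : Γ) ∉ S)
    (hgen : Subgroup.closure S = ⊤) (x y : Γ) : Nonempty ((Cay S).Walk x y) := by
  have h : ∀ g ∈ Subgroup.closure S, ∀ x, Nonempty ((Cay S).Walk x (x * g)) := by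
    intro g hg
    induction hg using Subgroup.closure_induction with
    | mem g hg =>
      exact fun x => ⟨SimpleGraph.Adj.toWalk ((cay_adj hS h1 _ _).2 (by simpa using hg))⟩
    | one => exact fun x => ⟨SimpleGraph.Walk.nil.copy rfl (mul_one x).symm⟩
    | mul g g' _ _ hg hg' =>
      intro x
      obtain ⟨p⟩ := hg x
      obtain ⟨q⟩ := hg' (x * g)
      exact ⟨(p.append q).copy rfl (mul_assoc _ _ _)⟩
    | inv g _ hg =>
      intro x
      obtain ⟨p⟩ := hg (x * g⁻¹)
      exact ⟨(p.reverse).copy (by group) rfl⟩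
  obtain ⟨p⟩ := h (x⁻¹ * y) (hgen ▸ Subgroup.mem_top _) x
  exact ⟨p.copy rfl (mul_inv_cancel_left _ _)⟩

/-! ### Coordinates on the Heisenberg group -/

/-- The element of `H₃(ℤ)` with coordinates `(a, b, c)`. -/
def ofCoord (p : ℤ × ℤ × ℤ) : H3 := ⟨heis p.1 p.2.1 p.2.2, _, _, _, rfl⟩

theorem ofCoord_injective : Function.Injective ofCoord := by
  rintro ⟨a, b, c⟩ ⟨a', b', c'⟩ h
  have h' : ∀ i j, (heis a b c).1 i j = (heis a' b' c').1 i j := fun i j =>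
    congrArg (fun M : H3 => M.1.1 i j) h
  have h01 := h' 0 1
  have h02 := h' 0 2
  have h12 := h' 1 2
  simp [heis] at h01 h02 h12
  simp [h01, h02, h12]

theorem ofCoord_surjective : Function.Surjective ofCoord := by
  rintro ⟨_, a, b, c, rfl⟩
  exact ⟨(a, b, c), rfl⟩

/-- Multiplication in coordinates. -/
def coordMul (p q : ℤ × ℤ × ℤ) : ℤ × ℤ × ℤ :=
  (p.1 + q.1, q.2.1 + p.1 * q.2.2 + p.2.1, p.2.2 + q.2.2)

/-- Inversion in coordinates. -/
def coordInv (p : ℤ × ℤ × ℤ) : ℤ × ℤ × ℤ := (-p.1, p.1 * p.2.2 - p.2.1, -p.2.2)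

theorem ofCoord_mul (p q : ℤ × ℤ × ℤ) : ofCoord p * ofCoord q = ofCoord (coordMul p q) :=
  Subtype.ext (heis_mul _ _ _ _ _ _)

theorem ofCoord_zero : ofCoord (0, 0, 0) = 1 := Subtype.ext heis_zero

theorem ofCoord_inv (p : ℤ × ℤ × ℤ) : (ofCoord p)⁻¹ = ofCoord (coordInv p) := by
  rw [inv_eq_iff_mul_eq_one, ofCoord_mul, ← ofCoord_zero]
  congr 1
  ext <;> simp [coordMul, coordInv]
  ring

theorem matA_eq : matA = ofCoord (1, 0, 0) := rfl

theorem matB_eq : matB = ofCoord (0, 0, 1) := rfl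

/-- The set `F ∪ F⁻¹`. -/
abbrev heisT : Set H3 := heisF ∪ heisF⁻¹

/-- The coordinates of the ten elements of `F ∪ F⁻¹`. -/
def genCoord : Fin 10 → ℤ × ℤ × ℤ :=
  ![(1, 0, 0), (2, 0, 0), (-1, 0, 0), (-2, 0, 0), (0, 0, 1), (0, 0, 2), (0, 0, -1), (0, 0, -2),
    (2, 2, 1), (-2, 0, -1)]

theorem heisF_eq : heisF = {ofCoord (1, 0, 0), ofCoord (0, 0, 1), ofCoord (2, 0, 0),
    ofCoord (2, 2, 1), ofCoord (0, 0, 2)} := by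
  simp [heisF, matA_eq, matB_eq, pow_two, ofCoord_mul, coordMul]

theorem heisT_eq : heisT = Set.range fun i => ofCoord (genCoord i) := by
  ext m
  simp only [heisT, heisF_eq, Set.mem_union, Set.mem_inv, Set.mem_insert_iff,
    Set.mem_singleton_iff, inv_eq_iff_eq_inv, ofCoord_inv, coordInv, Set.mem_range,
    Fin.exists_fin_succ, genCoord, IsEmpty.exists_iff, eq_comm (b := m)]
  simp
  tauto

theorem mem_heisT (p : ℤ × ℤ × ℤ) : ofCoord p ∈ heisT ↔ ∃ i, genCoord i = p := by
  rw [heisT_eq]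
  simp [ofCoord_injective.eq_iff]

theorem heisT_inv : heisT⁻¹ = heisT := by
  simp [heisT, Set.union_comm]

theorem one_notMem_heisT : (1 : H3) ∉ heisT := by
  rw [← ofCoord_zero, mem_heisT]
  decide

theorem closure_heisT : Subgroup.closure heisT = ⊤ := by
  rw [eq_top_iff]
  have hA : matA ∈ Subgroup.closure heisT :=
    Subgroup.subset_closure (Or.inl (by simp [heisF]))
  have hB : matB ∈ Subgroup.closure heisT :=
    Subgroup.subset_closure (Or.inl (by simp [heisF]))
  have hApow : ∀ n : ℤ, matA ^ n = ofCoord (n, 0, 0) := by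
    intro n
    induction n with
    | zero => exact ofCoord_zero.symm
    | succ n ih => rw [zpow_add_one, ih, matA_eq, ofCoord_mul]; simp [coordMul]
    | pred n ih =>
      rw [zpow_sub_one, ih, matA_eq, ofCoord_inv, ofCoord_mul]
      simp [coordMul, coordInv]
      rfl
  have hBpow : ∀ n : ℤ, matB ^ n = ofCoord (0, 0, n) := by
    intro n
    induction n with
    | zero => exact ofCoord_zero.symm
    | succ n ih => rw [zpow_add_one, ih, matB_eq, ofCoord_mul]; simp [coordMul]
    | pred n ih =>
      rw [zpow_sub_one, ih, matB_eq, ofCoord_inv, ofCoord_mul]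
      simp [coordMul, coordInv]
      rfl
  intro m _
  obtain ⟨⟨a, b, c⟩, rfl⟩ := ofCoord_surjective m
  -- `B ^ c * A ^ a` has coordinates `(a, 0, c)`, and the commutator of `A ^ b` and `B` is the
  -- central element `(0, b, 0)`.
  have : ofCoord (a, b, c) = matB ^ c * matA ^ a * (matA ^ b * matB * matA ^ (-b) * matB⁻¹) := by
    simp only [hApow, hBpow]
    simp [matB_eq, ofCoord_mul, ofCoord_inv, coordMul, coordInv]
  rw [this]
  have hA' := fun n => zpow_mem hA n
  exact mul_mem (mul_mem (zpow_mem hB _) (hA' _))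
    (mul_mem (mul_mem (mul_mem (hA' _) hB) (hA' _)) (inv_mem hB))

/-! ### Rigidity of the Cayley graph of `H₃(ℤ)` -/

/-- The graph induced by the Cayley graph on the neighbours of the identity. -/
def link : SimpleGraph (Fin 10) where
  Adj i j := ∃ k, genCoord k = coordMul (coordInv (genCoord i)) (genCoord j)
  symm := ⟨by decide +kernel⟩
  loopless := ⟨by decide +kernel⟩

instance : DecidableRel link.Adj := fun i j =>
  inferInstanceAs (Decidable (∃ k, genCoord k = coordMul (coordInv (genCoord i)) (genCoord j)))

theorem link_adj (i j : Fin 10) :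
    link.Adj i j ↔ (ofCoord (genCoord i))⁻¹ * ofCoord (genCoord j) ∈ heisT := by
  rw [ofCoord_inv, ofCoord_mul, mem_heisT]
  rfl

/-- The link is a tree: the path `A²B, A², A, A⁻¹, A⁻², B`, then `B` joined to `B²` and `B⁻¹`, and
`B⁻¹` joined to `B⁻²` and `(A²B)⁻¹`. Its vertices of degree 3 are `B` and `B⁻¹`, and only `B` has a
neighbour of degree 2. Following the path back from `B` fixes `A⁻²`, `A⁻¹` and `A` in turn. In the
abelianization inversion would be a symmetry of the link; noncommutativity removes the edges it
would need. -/
theorem link_iso_fixes (σ : link ≃g link) : σ 0 = 0 ∧ σ 4 = 4 := by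
  have hdeg : ∀ i, link.degree (σ i) = link.degree i := fun i => σ.degree_eq i
  have hadj : ∀ {i j}, link.Adj i j → link.Adj (σ i) (σ j) := fun h => σ.map_rel_iff.2 h
  have h4 : σ 4 = 4 := by
    have key : ∀ i j, link.degree i = 3 → link.degree j = 2 → link.Adj i j → i = 4 := by
      decide +kernel
    exact key _ (σ 3) ((hdeg _).trans (by decide +kernel)) ((hdeg _).trans (by decide +kernel))
      (hadj (by decide +kernel))
  have h3 : σ 3 = 3 := by
    have key : ∀ i, link.degree i = 2 → link.Adj 4 i → i = 3 := by decide +kernel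
    exact key _ ((hdeg _).trans (by decide +kernel)) (h4 ▸ hadj (by decide +kernel))
  have h2 : σ 2 = 2 := by
    have key : ∀ i, link.degree i = 2 → link.Adj 3 i → i = 2 := by decide +kernel
    exact key _ ((hdeg _).trans (by decide +kernel)) (h3 ▸ hadj (by decide +kernel))
  have h0 : σ 0 = 0 := by
    have key : ∀ i, i ≠ 3 → link.Adj 2 i → i = 0 := by decide +kernel
    refine key _ (fun h => ?_) (h2 ▸ hadj (by decide +kernel))
    exact absurd (σ.injective (h.trans h3.symm)) (by decide)
  exact ⟨h0, h4⟩

/-- For each `x` the map `t ↦ φ(x)⁻¹ φ(x t)` permutes the ten generators and is an automorphism of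
the link, hence fixes `A` and `B`. -/
theorem map_mul_generators (φ : CayAut heisT) (x : H3) :
    φ (x * matA) = φ x * matA ∧ φ (x * matB) = φ x * matB := by
  have hadj := cay_adj heisT_inv one_notMem_heisT
  have hex : ∀ i, ∃ j, ofCoord (genCoord j) = (φ x)⁻¹ * φ (x * ofCoord (genCoord i)) := by
    intro i
    have h : (Cay heisT).Adj (φ x) (φ (x * ofCoord (genCoord i))) := by
      rw [φ.map_rel_iff, hadj, inv_mul_cancel_left, mem_heisT]
      exact ⟨i, rfl⟩
    rw [hadj] at h
    exact heisT_eq.subset h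
  choose σ hσ using hex
  have hinj : Function.Injective σ := by
    intro i j h
    have h' := (hσ i).symm.trans (h ▸ hσ j)
    have h'' := mul_left_cancel (φ.injective (mul_left_cancel h'))
    have key : Function.Injective genCoord := by decide +kernel
    exact key (ofCoord_injective h'')
  let τ : link ≃g link :=
    { toEquiv := Equiv.ofBijective σ (Finite.injective_iff_bijective.1 hinj)
      map_rel_iff' := by
        intro i j
        change link.Adj (σ i) (σ j) ↔ _
        rw [link_adj, link_adj, hσ, hσ, mul_inv_rev, inv_inv, mul_assoc, mul_inv_cancel_left,
          ← hadj, φ.map_rel_iff, hadj, mul_inv_rev, mul_assoc, inv_mul_cancel_left] }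
  obtain ⟨h0, h4⟩ := link_iso_fixes τ
  constructor
  · have := hσ 0
    rw [show σ 0 = 0 from h0, eq_inv_mul_iff_mul_eq] at this
    exact this.symm
  · have := hσ 4
    rw [show σ 4 = 4 from h4, eq_inv_mul_iff_mul_eq] at this
    exact this.symm

theorem closure_matA_matB : Subgroup.closure {matA, matB} = ⊤ := by
  rw [eq_top_iff, ← closure_heisT, Subgroup.closure_le]
  have hA : matA ∈ Subgroup.closure {matA, matB} := Subgroup.subset_closure (by simp)
  have hB : matB ∈ Subgroup.closure {matA, matB} := Subgroup.subset_closure (by simp)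
  have hF : ∀ m ∈ heisF, m ∈ Subgroup.closure {matA, matB} := by
    rintro m (rfl | rfl | rfl | rfl | rfl)
    exacts [hA, hB, pow_mem hA 2, mul_mem (pow_mem hA 2) hB, pow_mem hB 2]
  rintro m (h | h)
  · exact hF m h
  · exact inv_mem_iff.1 (hF _ h)

theorem heis_rigid (φ : CayAut heisT) (m : H3) : φ m = φ 1 * m := by
  have h : ∀ g ∈ Subgroup.closure {matA, matB}, ∀ x, φ (x * g) = φ x * g := by
    intro g hg
    induction hg using Subgroup.closure_induction with
    | mem g hg =>
      rintro x
      rcases hg with rfl | rfl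
      exacts [(map_mul_generators φ x).1, (map_mul_generators φ x).2]
    | one => simp
    | mul g g' _ _ hg hg' => intro x; rw [← mul_assoc, hg', hg, mul_assoc]
    | inv g _ hg =>
      intro x
      rw [eq_mul_inv_iff_mul_eq, ← hg, inv_mul_cancel_right]
  simpa using h m (closure_matA_matB ▸ Subgroup.mem_top _) 1

/-- This separates neighbourhoods in `H₃(ℤ)`, so that the fibres can be read off from the graph.
Since `g * A` is one of the ten generators, only ten candidates for `g` have to be checked. -/
theorem eq_one_of_smul_heisT {g : H3} (h : ∀ t ∈ heisT, g * t ∈ heisT) : g = 1 := by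
  obtain ⟨p, rfl⟩ := ofCoord_surjective g
  have key : ∀ k, (∀ i, ∃ j, genCoord j = coordMul (coordMul (genCoord k)
      (coordInv (genCoord 0))) (genCoord i)) → coordMul (genCoord k)
      (coordInv (genCoord 0)) = (0, 0, 0) := by decide +kernel
  have h' : ∀ i, ∃ j, genCoord j = coordMul p (genCoord i) := by
    intro i
    rw [← mem_heisT, ← ofCoord_mul]
    exact h _ ((mem_heisT _).2 ⟨i, rfl⟩)
  obtain ⟨k, hk⟩ := h' 0
  have hp : p = coordMul (genCoord k) (coordInv (genCoord 0)) := by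
    apply ofCoord_injective
    rw [hk, ← ofCoord_mul, ← ofCoord_mul, ← ofCoord_inv, mul_inv_cancel_right]
  rw [hp, key k (hp ▸ h'), ofCoord_zero]

/-! ### The automorphisms of the Cayley graph of `C₂ × H₃(ℤ)` -/

theorem genE_inv : genE⁻¹ = genE := by
  ext ⟨a, m⟩
  simp [genE, or_comm]

theorem mem_genE (γ : HGroup) : γ ∈ genE ↔ γ.2 ∈ heisT := by
  simp [genE]

theorem one_notMem_genE : (1 : HGroup) ∉ genE := by
  rw [mem_genE]
  exact one_notMem_heisT

theorem genE_finite : genE.Finite := by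
  have : heisF.Finite := by simp [heisF]
  exact Set.finite_univ.prod (this.union this.inv)

theorem closure_genE : Subgroup.closure genE = ⊤ := by
  rw [eq_top_iff]
  have h1 : ∀ m : H3, ((1, m) : HGroup) ∈ Subgroup.closure genE := by
    intro m
    have : (⊤ : Subgroup H3) ≤ (Subgroup.closure genE).comap (MonoidHom.inr C2 H3) := by
      rw [← closure_heisT, Subgroup.closure_le]
      exact fun t ht => Subgroup.subset_closure ((mem_genE _).2 ht)
    exact this (Subgroup.mem_top m)
  rintro ⟨a, m⟩ -
  have hA : ((a, matA) : HGroup) ∈ Subgroup.closure genE :=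
    Subgroup.subset_closure ((mem_genE _).2 (Or.inl (by simp [heisF])))
  have : ((a, m) : HGroup) = (a, matA) * (1, matA⁻¹ * m) := by simp
  rw [this]
  exact mul_mem hA (h1 _)

theorem genE_adj (u v : HGroup) : (Cay genE).Adj u v ↔ u.2⁻¹ * v.2 ∈ heisT := by
  rw [cay_adj genE_inv one_notMem_genE, mem_genE]
  rfl

theorem snd_eq_of_adj {u v : HGroup} (h : ∀ w, (Cay genE).Adj u w → (Cay genE).Adj v w) :
    u.2 = v.2 := by
  have := eq_one_of_smul_heisT (g := v.2⁻¹ * u.2) fun t ht => by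
    have := h (1, u.2 * t) ((genE_adj _ _).2 (by simpa using ht))
    rw [genE_adj] at this
    simpa [mul_assoc] using this
  exact (inv_mul_eq_one.1 this).symm

theorem snd_map_eq (r : CayAut genE) {u v : HGroup} (h : u.2 = v.2) : (r u).2 = (r v).2 := by
  apply snd_eq_of_adj
  intro w hw
  obtain ⟨w, rfl⟩ := r.surjective w
  rw [r.map_rel_iff, genE_adj] at hw ⊢
  rwa [← h]

/-- The automorphism of the Cayley graph of `H₃(ℤ)` induced on the fibres. -/
def fibreAut (r : CayAut genE) : CayAut heisT where
  toFun m := (r (1, m)).2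
  invFun m := (r.symm (1, m)).2
  left_inv m := by
    have := snd_map_eq r.symm (u := (1, (r (1, m)).2)) (v := r (1, m)) rfl
    simpa using this
  right_inv m := by
    have := snd_map_eq r (u := (1, (r.symm (1, m)).2)) (v := r.symm (1, m)) rfl
    simpa using this
  map_rel_iff' {m n} := by
    change (Cay heisT).Adj (r (1, m)).2 (r (1, n)).2 ↔ _
    rw [cay_adj heisT_inv one_notMem_heisT, cay_adj heisT_inv one_notMem_heisT, ← genE_adj,
      r.map_rel_iff, genE_adj]

theorem snd_aut (r : CayAut genE) (u : HGroup) : (r u).2 = (r 1).2 * u.2 :=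
  (snd_map_eq r (u := u) (v := (1, u.2)) rfl).trans (heis_rigid (fibreAut r) u.2)

/-- An injection between two-point fibres is a translation of `C₂`. -/
theorem fst_aut (r : CayAut genE) (a : C2) (m : H3) : (r (a, m)).1 = a * (r (1, m)).1 := by
  by_cases ha : a = 1
  · simp [ha]
  have hne : (r (a, m)).1 ≠ (r (1, m)).1 := by
    intro h
    have := r.injective (Prod.ext h (snd_map_eq r rfl))
    exact ha (congrArg Prod.fst this)
  have key : ∀ a u v : C2, a ≠ 1 → u ≠ v → u = a * v := by decide
  exact key _ _ _ ha hne

/-! ### Cayley diagrams and rotations -/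

section CayleyDiagrams

variable {Γ : Type*} [Group Γ] {S : Set Γ}

theorem labelProd_cons (d : EdgeLabelling S) {x y z : Γ} (h : (Cay S).Adj x y)
    (p : (Cay S).Walk y z) :
    labelProd d (.cons h p) = d ⟨(x, y), h⟩ * labelProd d p := by
  simp [labelProd]

theorem labelProd_append (d : EdgeLabelling S) {x y z : Γ} (p : (Cay S).Walk x y)
    (q : (Cay S).Walk y z) :
    labelProd d (p.append q) = labelProd d p * labelProd d q := by
  simp [labelProd]

theorem labelProd_eq_of_label {d : EdgeLabelling S} {r : Γ → Γ}
    (hd : ∀ e : (Cay S).Dart, (d e : Γ) = (r e.fst)⁻¹ * r e.snd) {x y : Γ}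
    (p : (Cay S).Walk x y) : labelProd d p = (r x)⁻¹ * r y := by
  induction p with
  | nil => simp [labelProd]
  | cons h p ih => rw [labelProd_cons, ih, hd]; simp [mul_assoc]

/-- The labelling `(x, y) ↦ r(x)⁻¹ r(y)`. -/
def diagramOf (hS : S⁻¹ = S) (h1 : (1 : Γ) ∉ S) (r : CayAut S) : EdgeLabelling S :=
  fun e => ⟨(r e.fst)⁻¹ * r e.snd, (cay_adj hS h1 _ _).1 (r.map_rel_iff.2 e.adj)⟩

theorem isCayleyDiagram_diagramOf (hS : S⁻¹ = S) (h1 : (1 : Γ) ∉ S) (r : CayAut S) :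
    IsCayleyDiagram (diagramOf hS h1 r) where
  at_most_one := by
    rintro ⟨⟨x, y⟩, h⟩ ⟨⟨x', y'⟩, h'⟩ hx hd
    obtain rfl : x = x' := hx
    have hd' : (r x)⁻¹ * r y = (r x)⁻¹ * r y' := congrArg Subtype.val hd
    obtain rfl : y = y' := r.injective (mul_left_cancel hd')
    rfl
  exists_edge x γ := by
    refine ⟨⟨(x, r.symm (r x * γ)), ?_⟩, rfl, ?_⟩
    · rw [← r.map_rel_iff, cay_adj hS h1]
      simp
    · apply Subtype.ext
      simp [diagramOf]
  closed_iff x y p := by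
    rw [labelProd_eq_of_label (r := r) (fun _ => rfl), inv_mul_eq_one]
    exact r.injective.eq_iff

variable {d : EdgeLabelling S} (hd : IsCayleyDiagram d)
include hd

theorem IsCayleyDiagram.labelProd_reverse {x y : Γ} (p : (Cay S).Walk x y) :
    labelProd d p.reverse = (labelProd d p)⁻¹ := by
  rw [eq_inv_iff_mul_eq_one, ← labelProd_append]
  exact (hd.closed_iff _ _ _).2 rfl

theorem IsCayleyDiagram.labelProd_eq {x y : Γ} (p q : (Cay S).Walk x y) :
    labelProd d p = labelProd d q := by
  rw [← inv_mul_eq_one, ← hd.labelProd_reverse, ← labelProd_append]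
  exact (hd.closed_iff _ _ _).2 rfl

theorem IsCayleyDiagram.exists_rotation (hS : S⁻¹ = S) (h1 : (1 : Γ) ∉ S)
    (hgen : Subgroup.closure S = ⊤) :
    ∃ r : rotations S, diagramOf hS h1 r.1 = d := by
  have hw := fun x => (exists_walk hS h1 hgen 1 x).some
  -- The product of labels along a walk depends only on its endpoints, so it has a potential `ψ`,
  -- normalised by `ψ 1 = 1`. This potential is the rotation sought.
  obtain ⟨ψ, hψ⟩ : ∃ ψ : Γ → Γ, ∀ {x} (p : (Cay S).Walk 1 x), labelProd d p = ψ x :=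
    ⟨fun x => labelProd d (hw x), fun p => hd.labelProd_eq p _⟩
  have hwalk : ∀ {x y} (p : (Cay S).Walk x y), labelProd d p = (ψ x)⁻¹ * ψ y := by
    intro x y p
    rw [← hψ (hw x), ← hψ ((hw x).append p), labelProd_append, inv_mul_cancel_left]
  have hedge : ∀ e : (Cay S).Dart, (d e : Γ) = (ψ e.fst)⁻¹ * ψ e.snd := by
    intro e
    rw [← hwalk e.adj.toWalk]
    simp [labelProd]
  have hψ1 : ψ 1 = 1 := by
    rw [← hψ .nil]
    simp [labelProd]
  have hinj : Function.Injective ψ := by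
    intro x y h
    obtain ⟨p⟩ := exists_walk hS h1 hgen x y
    exact (hd.closed_iff x y p).1 (by rw [hwalk, h, inv_mul_cancel])
  have hstep : ∀ x, ∀ γ ∈ S, ∃ y, (Cay S).Adj x y ∧ ψ y = ψ x * γ := by
    intro x γ hγ
    obtain ⟨e, rfl, he⟩ := hd.exists_edge x ⟨γ, hγ⟩
    refine ⟨e.snd, e.adj, ?_⟩
    rw [← eq_inv_mul_iff_mul_eq.1 (hedge e), he]
  -- The range of `ψ` contains `1` and, by `hstep`, is closed under passing to neighbours; the graph
  -- is connected.
  have hsurj : Function.Surjective ψ := by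
    intro γ
    have hwalk' : ∀ {x y : Γ} (_ : (Cay S).Walk x y), x ∈ Set.range ψ → y ∈ Set.range ψ := by
      intro x y p
      induction p with
      | nil => exact id
      | cons h p ih =>
        rintro ⟨u, rfl⟩
        apply ih
        obtain ⟨z, -, hz⟩ := hstep u _ ((cay_adj hS h1 _ _).1 h)
        exact ⟨z, by rw [hz, mul_inv_cancel_left]⟩
    exact hwalk' (hw γ) ⟨1, hψ1⟩
  let r : CayAut S :=
    { toEquiv := Equiv.ofBijective ψ ⟨hinj, hsurj⟩
      map_rel_iff' := by
        intro x y
        change (Cay S).Adj (ψ x) (ψ y) ↔ _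
        constructor
        · intro h
          obtain ⟨z, hz, hz'⟩ := hstep x _ ((cay_adj hS h1 _ _).1 h)
          rw [mul_inv_cancel_left] at hz'
          rwa [← hinj hz']
        · intro h
          rw [cay_adj hS h1, ← hedge ⟨(x, y), h⟩]
          exact (d _).2 }
  exact ⟨⟨r, hψ1⟩, funext fun e => Subtype.ext (hedge e).symm⟩

omit hd

theorem rotation_ext (hS : S⁻¹ = S) (h1 : (1 : Γ) ∉ S) (hgen : Subgroup.closure S = ⊤)
    {r s : rotations S} (h : diagramOf hS h1 r.1 = diagramOf hS h1 s.1) : r = s := by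
  apply Subtype.ext
  apply RelIso.ext
  intro x
  obtain ⟨p⟩ := exists_walk hS h1 hgen 1 x
  have hr := labelProd_eq_of_label (d := diagramOf hS h1 r.1) (r := r.1) (fun _ => rfl) p
  have hs := labelProd_eq_of_label (d := diagramOf hS h1 s.1) (r := s.1) (fun _ => rfl) p
  rw [h, hs, show r.1 1 = 1 from r.2, show s.1 1 = 1 from s.2] at hr
  simpa using hr.symm

theorem mk_CD_eq_mk_rotations {Γ : Type*} [Group Γ] {S : Set Γ} (hS : S⁻¹ = S)
    (h1 : (1 : Γ) ∉ S) (hgen : Subgroup.closure S = ⊤) : #(CD S) = #(rotations S) := by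
  refine (Cardinal.mk_congr (Equiv.ofBijective
    (fun r : rotations S => (⟨diagramOf hS h1 r.1, isCayleyDiagram_diagramOf hS h1 r.1⟩ : CD S))
    ⟨fun r s h => rotation_ext hS h1 hgen (congrArg Subtype.val h), ?_⟩)).symm
  rintro ⟨d, hd⟩
  obtain ⟨r, rfl⟩ := IsCayleyDiagram.exists_rotation hd hS h1 hgen
  exact ⟨r, rfl⟩

end CayleyDiagrams

/-! ### Measurability of the set of Cayley diagrams -/

section Measurability

variable {Γ : Type*} [Group Γ] {S : Set Γ}

theorem measurableSet_label (e : (Cay S).Dart) (s : Set S) :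
    MeasurableSet {d : EdgeLabelling S | d e ∈ s} :=
  @measurable_pi_apply _ (fun _ => S) (fun _ => ⊤) e s trivial

theorem measurableSet_listProd [Countable Γ] (l : List (Cay S).Dart) (g : Γ) :
    MeasurableSet {d : EdgeLabelling S | (l.map fun e => (d e : Γ)).prod = g} := by
  induction l generalizing g with
  | nil => simp
  | cons e l ih =>
    have : {d : EdgeLabelling S | ((e :: l).map fun e => (d e : Γ)).prod = g} =
        ⋃ γ : S, {d : EdgeLabelling S | d e ∈ ({γ} : Set S)} ∩
          {d : EdgeLabelling S | (l.map fun e => (d e : Γ)).prod = (γ : Γ)⁻¹ * g} := by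
      ext d
      simp [eq_inv_mul_iff_mul_eq]
    rw [this]
    exact .iUnion fun γ => (measurableSet_label e _).inter (ih _)

theorem countable_dart [Countable Γ] : Countable (Cay S).Dart :=
  Function.Injective.countable (f := SimpleGraph.Dart.toProd) SimpleGraph.Dart.toProd_injective

/-- Needed to pull an almost sure statement about the image measure back to the i.i.d. labels. Walks
are replaced by their lists of darts, so that all quantifiers range over countable types. -/
theorem measurableSet_CD [Countable Γ] : MeasurableSet (CD S) := by
  have := countable_dart (S := S)
  have hCD : CD S = {d | ∀ e e' : (Cay S).Dart, e.fst = e'.fst → d e = d e' → e = e'} ∩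
      {d | ∀ (x : Γ) (γ : S), ∃ e : (Cay S).Dart, e.fst = x ∧ d e = γ} ∩
      {d | ∀ (x y : Γ) (l : List (Cay S).Dart), (∃ p : (Cay S).Walk x y, p.darts = l) →
        ((l.map fun e => (d e : Γ)).prod = 1 ↔ x = y)} := by
    ext d
    constructor
    · rintro ⟨h1, h2, h3⟩
      refine ⟨⟨h1, h2⟩, ?_⟩
      rintro x y _ ⟨p, rfl⟩
      exact h3 x y p
    · rintro ⟨⟨h1, h2⟩, h3⟩
      exact ⟨h1, h2, fun x y p => h3 x y _ ⟨p, rfl⟩⟩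
  rw [hCD]
  have heq : ∀ e e', MeasurableSet {d : EdgeLabelling S | d e = d e'} := by
    intro e e'
    have : {d : EdgeLabelling S | d e = d e'} =
        ⋃ γ : S, {d | d e ∈ ({γ} : Set S)} ∩ {d | d e' ∈ ({γ} : Set S)} := by
      ext d
      simp only [Set.mem_iUnion, Set.mem_inter_iff, Set.mem_ofPred_eq, Set.mem_singleton_iff]
      exact ⟨fun h => ⟨_, h, rfl⟩, fun ⟨γ, h, h'⟩ => h.trans h'.symm⟩
    rw [this]
    exact .iUnion fun γ => (measurableSet_label e _).inter (measurableSet_label e' _)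
  refine (MeasurableSet.inter ?_ ?_).inter ?_
  · simp only [Set.ofPred_forall]
    exact .iInter fun e => .iInter fun e' => .iInter fun _ => (heq e e').imp (.const _)
  · simp only [Set.ofPred_forall, Set.ofPred_exists]
    exact .iInter fun x => .iInter fun γ => .iUnion fun e =>
      (MeasurableSet.const _).inter (measurableSet_label e {γ})
  · simp only [Set.ofPred_forall]
    exact .iInter fun x => .iInter fun y => .iInter fun l => .iInter fun _ =>
      (measurableSet_listProd l 1).iff (.const _)

end Measurability

/-! ### A Cayley diagram as a factor of i.i.d. labels -/

theorem C2_mul_self (a : C2) : a * a = 1 := by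
  revert a
  decide

theorem C2_inv (a : C2) : a⁻¹ = a := inv_eq_of_mul_eq_one_left (C2_mul_self a)

instance : DiscreteMeasurableSpace C2 := ⟨fun _ => trivial⟩

/-- The automorphism `(a, m) ↦ (a + t(m), m)`. -/
def switchAut (t : H3 → C2) : CayAut genE where
  toFun u := (u.1 * t u.2, u.2)
  invFun u := (u.1 * t u.2, u.2)
  left_inv u := by simp [mul_assoc, C2_mul_self]
  right_inv u := by simp [mul_assoc, C2_mul_self]
  map_rel_iff' {u v} := by
    change (Cay genE).Adj (u.1 * t u.2, u.2) (v.1 * t v.2, v.2) ↔ _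
    rw [genE_adj, genE_adj]

theorem switchAut_apply (t : H3 → C2) (u : HGroup) : switchAut t u = (u.1 * t u.2, u.2) := rfl

/-- The element of the fibre over `m` that carries the larger label. -/
noncomputable def largerLabel (x : HGroup → unitInterval) (m : H3) : C2 :=
  if x (1, m) < x (Multiplicative.ofAdd 1, m) then Multiplicative.ofAdd 1 else 1

theorem measurable_largerLabel (m : H3) : Measurable fun x => largerLabel x m :=
  Measurable.ite (measurableSet_lt (measurable_pi_apply _) (measurable_pi_apply _))
    measurable_const measurable_const

/-- The Cayley diagram obtained by marking in each fibre the element with the larger label. -/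
noncomputable def labelDiagram (x : HGroup → unitInterval) : EdgeLabelling genE :=
  diagramOf genE_inv one_notMem_genE (switchAut (largerLabel x))

theorem measurable_labelDiagram : Measurable labelDiagram := by
  refine (@measurable_pi_iff _ _ (fun _ => genE) _ (fun _ => ⊤) _).2 fun e => ?_
  -- The label of an edge is a function of the two marks in the fibres of its endpoints, that is, of
  -- a point of the finite discrete space `C2 × C2`.
  have hmem : ∀ s : C2 × C2,
      ((e.fst.1 * s.1, e.fst.2)⁻¹ * (e.snd.1 * s.2, e.snd.2) : HGroup) ∈ genE := fun s =>
    (mem_genE _).2 ((genE_adj e.fst e.snd).1 e.adj)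
  intro t _
  have ht : MeasurableSet {s : C2 × C2 | (⟨_, hmem s⟩ : genE) ∈ t} := .of_discrete
  exact ((measurable_largerLabel e.fst.2).prodMk (measurable_largerLabel e.snd.2)) ht

/-- The labellings that separate the points of every fibre. -/
def separating : Set (HGroup → unitInterval) :=
  {x | ∀ m, x (1, m) ≠ x (Multiplicative.ofAdd 1, m)}

theorem measurableSet_separating : MeasurableSet separating := by
  have : separating = ⋂ m : H3, {x | x (1, m) = x (Multiplicative.ofAdd 1, m)}ᶜ := by
    ext x
    simp [separating]
  rw [this]
  exact .iInter fun m => (measurableSet_eq_fun (by fun_prop) (by fun_prop)).compl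

/-- Two distinct coordinates have the product law, and the diagonal is null by Fubini because
Lebesgue measure has no atoms. -/
theorem iidMeasure_eq_null {ι : Type*} {i j : ι} (h : i ≠ j) :
    iidMeasure ι {x | x i = x j} = 0 := by
  have hmap := Measure.infinitePi_map_eval_prod
    (P := fun _ : ι => (volume : Measure unitInterval)) h
  have hdiag : MeasurableSet (Set.diagonal unitInterval) := measurableSet_diagonal
  have : iidMeasure ι {x | x i = x j} =
      (iidMeasure ι).map (fun x => (x i, x j)) (Set.diagonal unitInterval) := by
    rw [Measure.map_apply (by fun_prop) hdiag]
    rfl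
  rw [this, iidMeasure, hmap, Measure.prod_apply hdiag]
  have hsingle : ∀ t : unitInterval, Prod.mk t ⁻¹' Set.diagonal unitInterval = {t} := by
    intro t
    ext s
    simp [eq_comm]
  simp [hsingle]

theorem iidMeasure_separating_compl : iidMeasure HGroup separatingᶜ = 0 := by
  have : separatingᶜ = ⋃ m : H3,
      {x : HGroup → unitInterval | x (1, m) = x (Multiplicative.ofAdd 1, m)} := by
    ext x
    simp [separating]
  rw [this, measure_iUnion_null_iff]
  refine fun m => iidMeasure_eq_null fun h => ?_
  have h' : (1 : C2) = Multiplicative.ofAdd 1 := congrArg Prod.fst h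
  exact absurd h' (by decide)

theorem aut_apply (f : CayAut genE) (a : C2) (m : H3) :
    f (a, m) = (a * (f (1, m)).1, (f 1).2 * m) :=
  Prod.ext (fst_aut f a m) (snd_aut f (a, m))

theorem C2_cases (a : C2) : a = 1 ∨ a = Multiplicative.ofAdd 1 := by
  revert a
  decide

theorem comp_aut_mem_separating (f : CayAut genE) {x : HGroup → unitInterval}
    (hx : x ∈ separating) : x ∘ f ∈ separating := by
  intro m
  have h := hx ((f 1).2 * m)
  simp only [Function.comp_apply]
  rw [aut_apply f (Multiplicative.ofAdd 1) m, aut_apply f 1 m]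
  rcases C2_cases (f (1, m)).1 with h1 | h1 <;> rw [h1]
  · simpa using h
  · rw [one_mul, C2_mul_self]
    exact h.symm

/-- The marked point moves along with the fibre. Ties must be excluded: there the mark defaults to
the point with first coordinate `1`, a choice that automorphisms do not respect. -/
theorem largerLabel_comp (f : CayAut genE) {x : HGroup → unitInterval} (hx : x ∈ separating)
    (m : H3) : largerLabel (x ∘ f) m = (f (1, m)).1 * largerLabel x ((f 1).2 * m) := by
  have h := hx ((f 1).2 * m)
  change (if x (f (1, m)) < x (f (Multiplicative.ofAdd 1, m)) then _ else _) = _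
  rw [largerLabel, aut_apply f (Multiplicative.ofAdd 1) m, aut_apply f 1 m]
  rcases C2_cases (f (1, m)).1 with h1 | h1 <;> rw [h1]
  · simp
  · rw [one_mul, C2_mul_self]
    rcases lt_or_gt_of_ne h with h2 | h2
    · rw [if_neg h2.asymm, if_pos h2, C2_mul_self]
    · rw [if_pos h2, if_neg h2.asymm, mul_one]

theorem labelDiagram_comp (f : CayAut genE) {x : HGroup → unitInterval} (hx : x ∈ separating)
    (e : (Cay genE).Dart) :
    labelDiagram (x ∘ f) e = labelDiagram x (SimpleGraph.Hom.mapDart f.toHom e) := by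
  -- Relative to the marked points, `f` is left translation by `(1, (f 1).2)`, which cancels in the
  -- label of an edge.
  have key : ∀ u : HGroup, switchAut (largerLabel x) (f u) =
      (1, (f 1).2) * switchAut (largerLabel (x ∘ f)) u := by
    rintro ⟨a, m⟩
    rw [aut_apply f a m, switchAut_apply, switchAut_apply]
    simp only [largerLabel_comp f hx, Prod.mk_mul_mk, one_mul, mul_assoc]
  apply Subtype.ext
  change _ = (switchAut (largerLabel x) (f e.fst))⁻¹ * switchAut (largerLabel x) (f e.snd)
  rw [key, key, mul_inv_rev, mul_assoc, inv_mul_cancel_left]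
  rfl

theorem admitsAutFIIDCayleyDiagram_genE : AdmitsAutFIIDCayleyDiagram genE := by
  refine ⟨_, ⟨labelDiagram, measurable_labelDiagram, rfl, separating, measurableSet_separating,
    iidMeasure_separating_compl, ?_, ?_⟩, ?_⟩
  · exact fun f x hx => comp_aut_mem_separating f.symm hx
  · exact fun f x hx => funext fun e => labelDiagram_comp f.symm hx e
  · refine (ae_map_iff measurable_labelDiagram.aemeasurable measurableSet_CD).2 ?_
    -- Every `x`, with or without ties, yields a Cayley diagram; `separating` matters only for
    -- equivariance.
    exact .of_forall fun x => isCayleyDiagram_diagramOf _ _ _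

/-! ### The group of rotations -/

theorem Switch.ext_one (x : Switch) : x.ext 1 = 1 := by simp [Switch.ext]

theorem Switch.ext_of_ne (x : Switch) {m : H3} (h : m ≠ 1) : x.ext m = x ⟨m, h⟩ := by
  simp [Switch.ext, h]

theorem Switch.continuous_ext (m : H3) : Continuous fun x : Switch => x.ext m := by
  by_cases h : m = 1
  · simpa only [h, Switch.ext_one] using continuous_const
  · simpa only [Switch.ext_of_ne _ h] using continuous_apply _

theorem rotation_apply (r : rotations genE) (a : C2) (m : H3) :
    r.1 (a, m) = (a * (r.1 (1, m)).1, m) := by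
  have h : r.1 1 = 1 := r.2
  rw [aut_apply r.1 a m, h]
  simp

/-- The isomorphism from the group of rotations to `C₂^{H₃(ℤ) ∖ {I}}`. -/
noncomputable def rotationsEquiv : rotations genE ≃* Switch where
  toFun r m := (r.1 (1, m.1)).1
  invFun x := ⟨switchAut x.ext, by
    change switchAut x.ext 1 = 1
    simp [switchAut_apply, Switch.ext_one]⟩
  left_inv r := by
    apply Subtype.ext
    apply RelIso.ext
    rintro ⟨a, m⟩
    rw [rotation_apply r, switchAut_apply]
    congr 2
    by_cases h : m = 1
    · have h1 : r.1 (1, 1) = 1 := r.2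
      simp [h, Switch.ext_one, h1]
    · simp [Switch.ext_of_ne _ h]
  right_inv x := by
    funext m
    simp [switchAut_apply, Switch.ext_of_ne _ m.2]
  map_mul' r s := by
    funext m
    change (r.1 (s.1 (1, m.1))).1 = _
    rw [rotation_apply s, rotation_apply r, one_mul]
    exact mul_comm _ _

theorem rotationsEquiv_spec (r : rotations genE) (a : C2) (m : H3) :
    r.1 (a, m) = (a * (rotationsEquiv r).ext m, m) := by
  conv_lhs => rw [← rotationsEquiv.symm_apply_apply r]
  rfl

theorem continuous_aut_apply {V : Type*} {G : SimpleGraph V} (v : V) {Y : Type*}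
    [TopologicalSpace Y] (g : V → Y) : Continuous fun f : G ≃g G => g (f v) := by
  let : TopologicalSpace V := ⊥
  have : DiscreteTopology V := ⟨rfl⟩
  have h : Continuous fun f : G ≃g G => (fun v => f v : V → V) := continuous_induced_dom
  exact continuous_of_discreteTopology.comp ((continuous_apply v).comp h)

theorem continuous_rotationsEquiv : Continuous rotationsEquiv :=
  continuous_pi fun m => (continuous_aut_apply (1, m.1) Prod.fst).comp continuous_subtype_val

theorem continuous_rotationsEquiv_symm : Continuous rotationsEquiv.symm := by
  refine Continuous.subtype_mk (continuous_induced_rng.2 ?_) _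
  refine @continuous_pi _ _ (fun _ => HGroup) _ (fun _ => (⊥ : TopologicalSpace HGroup)) _
    fun v => ?_
  exact @Continuous.comp _ _ _ _ _ (⊥ : TopologicalSpace HGroup) _
    (fun c : C2 => ((v.1 * c, v.2) : HGroup))
    (@continuous_of_discreteTopology _ _ _ _ (⊥ : TopologicalSpace HGroup) _) (Switch.continuous_ext v.2)

theorem rotationsEquiv_rotAction (γ : HGroup) (r : rotations genE) :
    rotationsEquiv (rotAction genE γ r) = switchAction γ (rotationsEquiv r) := by
  funext m
  change ((r.1 γ⁻¹)⁻¹ * r.1 (γ⁻¹ * (1, m.1))).1 = _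
  obtain ⟨b, l⟩ := γ
  simp only [Prod.inv_mk, Prod.mk_mul_mk, rotationsEquiv_spec, switchAction, C2_inv, mul_inv,
    mul_one]
  -- The factor `b` enters once through `r(γ⁻¹)` and once through `r(γ⁻¹ (1, m))`, and the two
  -- cancel.
  rw [mul_comm b, mul_assoc, ← mul_assoc b b, C2_mul_self, one_mul]

theorem one_lt_mk_rotations : 1 < #(rotations genE) := by
  rw [Cardinal.mk_congr rotationsEquiv.toEquiv, Cardinal.one_lt_iff_nontrivial]
  have hA : matA ≠ 1 := by
    rw [matA_eq, ← ofCoord_zero, ofCoord_injective.ne_iff]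
    decide
  have : Nonempty {m : H3 // m ≠ 1} := ⟨⟨matA, hA⟩⟩
  exact Function.nontrivial

/-! ### Fair coins -/

theorem coinMap_apply (y : HGroup → C2) (m : {m : H3 // m ≠ 1}) :
    coinMap y m = y (1, m.1) * y (Multiplicative.ofAdd 1, m.1) * y (1, 1) *
      y (Multiplicative.ofAdd 1, 1) := rfl

theorem coinMap_mul (y z : HGroup → C2) : coinMap (y * z) = coinMap y * coinMap z := by
  funext m
  simp only [coinMap_apply, Pi.mul_apply]
  ac_rfl

theorem coinMap_surjective : Function.Surjective coinMap := by
  intro x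
  -- Put `x` on one sheet and the identity on the other; `x.ext 1 = 1` makes the correction at `I`
  -- trivial.
  refine ⟨fun u => if u.1 = 1 then x.ext u.2 else 1, ?_⟩
  funext m
  have h : Multiplicative.ofAdd (1 : ZMod 2) ≠ 1 := by decide
  simp [coinMap_apply, h, Switch.ext_one, Switch.ext_of_ne _ m.2]

theorem continuous_coinMap : Continuous coinMap := by
  refine continuous_pi fun m => ?_
  simp only [coinMap_apply]
  fun_prop

/-- The correction term at `I` makes the formula take the value `1` at `m = I`, which agrees with
the default value of `Switch.ext`. -/
theorem coinMap_ext (y : HGroup → C2) (m : H3) :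
    (coinMap y).ext m = y (1, m) * y (Multiplicative.ofAdd 1, m) * y (1, 1) *
      y (Multiplicative.ofAdd 1, 1) := by
  by_cases h : m = 1
  · rw [h, Switch.ext_one, mul_assoc (y _ * y _), C2_mul_self]
  · rw [Switch.ext_of_ne _ h, coinMap_apply]

/-- The `C₂` part of `γ` only permutes the two factors of a fibre product. -/
theorem coinShift_fibre (γ : HGroup) (y : HGroup → C2) (m : H3) :
    coinShift γ y (1, m) * coinShift γ y (Multiplicative.ofAdd 1, m) =
      y (1, γ.2⁻¹ * m) * y (Multiplicative.ofAdd 1, γ.2⁻¹ * m) := by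
  obtain ⟨b, l⟩ := γ
  simp only [coinShift, Prod.inv_mk, Prod.mk_mul_mk, C2_inv]
  rcases C2_cases b with rfl | rfl
  · simp
  · rw [C2_mul_self, mul_one, mul_comm]

theorem coinMap_coinShift (γ : HGroup) (y : HGroup → C2) :
    coinMap (coinShift γ y) = switchAction γ (coinMap y) := by
  funext m
  rw [coinMap_apply, mul_assoc (_ * _), coinShift_fibre, coinShift_fibre, switchAction,
    coinMap_ext, coinMap_ext, mul_one]
  -- On the right the fibre product at `I` occurs twice and cancels, leaving an identity in six
  -- elements of `C₂`.
  generalize y (1, 1) = p, y (Multiplicative.ofAdd 1, 1) = q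
  generalize y (1, γ.2⁻¹) = a, y (Multiplicative.ofAdd 1, γ.2⁻¹) = b
  generalize y (1, γ.2⁻¹ * m.1) = c, y (Multiplicative.ofAdd 1, γ.2⁻¹ * m.1) = d
  revert p q a b c d
  decide

/-- Uniqueness of Haar measure, the scalar being the total mass `1`. -/
theorem haarMeasure_top_eq {G : Type*} [Group G] [TopologicalSpace G] [IsTopologicalGroup G]
    [CompactSpace G] [SecondCountableTopology G] [MeasurableSpace G] [BorelSpace G]
    (μ : Measure G) [IsProbabilityMeasure μ] [μ.IsMulLeftInvariant] :
    μ = Measure.haarMeasure ⊤ := by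
  rw [Measure.haarMeasure_unique μ ⊤]
  simp

theorem uniform_map_mul_left (c : C2) :
    (PMF.uniformOfFintype C2).toMeasure.map (c * ·) = (PMF.uniformOfFintype C2).toMeasure := by
  classical
  ext s hs
  rw [Measure.map_apply (by fun_prop) hs, PMF.toMeasure_uniformOfFintype_apply _ (by measurability),
    PMF.toMeasure_uniformOfFintype_apply _ hs]
  congr 2
  exact Fintype.card_congr ((Equiv.mulLeft c).subtypeEquiv fun _ => Iff.rfl)

instance : IsProbabilityMeasure coinMeasure := by
  unfold coinMeasure
  infer_instance

instance : coinMeasure.IsMulLeftInvariant where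
  map_mul_left_eq_self y := by
    have h := Measure.infinitePi_map_pi (μ := fun _ : HGroup => (PMF.uniformOfFintype C2).toMeasure)
      (f := fun γ => (y γ * ·)) fun _ => by fun_prop
    simp only [uniform_map_mul_left] at h
    exact h

theorem coinMeasure_eq_haarMeasure : coinMeasure = Measure.haarMeasure ⊤ :=
  haarMeasure_top_eq coinMeasure

theorem coinMeasure_map_coinMap : coinMeasure.map coinMap = Measure.haarMeasure ⊤ := by
  rw [coinMeasure_eq_haarMeasure]
  -- A continuous surjective homomorphism of compact groups carries Haar measure to Haar measure
  -- once the total masses agree; both are `1`.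
  exact (MonoidHom.measurePreserving (f := MonoidHom.mk' coinMap coinMap_mul) continuous_coinMap
    coinMap_surjective (by
      rw [← TopologicalSpace.PositiveCompacts.coe_top, Measure.haarMeasure_self,
        ← TopologicalSpace.PositiveCompacts.coe_top, Measure.haarMeasure_self])).map_eq

end CayleyFIID

open CayleyFIID in
theorem mainTheorem9 :
    -- the set `E` is a finite symmetric generating set of `C₂ × H₃(ℤ)`
    (genE.Finite ∧ genE⁻¹ = genE ∧ Subgroup.closure genE = ⊤) ∧
    -- the Cayley graph admits a Cayley diagram that is a factor of i.i.d. for all automorphisms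
    AdmitsAutFIIDCayleyDiagram genE ∧
    -- there are as many Cayley diagrams as rotations, and more than one
    (#(CD genE) = #(rotations genE) ∧ 1 < #(CD genE)) ∧
    -- the rotation group is `C₂^{H₃(ℤ) ∖ {I}}` as a topological group, compatibly with the actions
    (∃ f : rotations genE ≃* Switch,
      Continuous f ∧ Continuous f.symm ∧
      (∀ (r : rotations genE) (a : C2) (m : H3), r.1 (a, m) = (a * (f r).ext m, m)) ∧
      (∀ (γ : HGroup) (r : rotations genE), f (rotAction genE γ r) = switchAction γ (f r))) ∧
    -- the explicit map is a surjective continuous homomorphism, equivariant, and carries the law of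
    -- fair coins, which is Haar measure, to Haar measure
    ((∀ y z : HGroup → C2, coinMap (y * z) = coinMap y * coinMap z) ∧
      Function.Surjective coinMap ∧ Continuous coinMap ∧
      (∀ (γ : HGroup) (y : HGroup → C2),
        coinMap (coinShift γ y) = switchAction γ (coinMap y)) ∧
      coinMeasure = Measure.haarMeasure ⊤ ∧
      coinMeasure.map coinMap = Measure.haarMeasure ⊤) := by
  refine ⟨⟨genE_finite, genE_inv, closure_genE⟩, admitsAutFIIDCayleyDiagram_genE, ?_, ?_, ?_⟩
  · have h := mk_CD_eq_mk_rotations genE_inv one_notMem_genE closure_genE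
    exact ⟨h, h ▸ one_lt_mk_rotations⟩
  · exact ⟨rotationsEquiv, continuous_rotationsEquiv, continuous_rotationsEquiv_symm,
      rotationsEquiv_spec, rotationsEquiv_rotAction⟩
  · exact ⟨coinMap_mul, coinMap_surjective, continuous_coinMap, coinMap_coinShift,
      coinMeasure_eq_haarMeasure, coinMeasure_map_coinMap⟩
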